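/- Let $n,k,l$ be integers with $2\le k\le n$ and $0\le l\le k-2$. Let $(M,g')$ be a compact smooth Riemannian manifold without boundary of dimension $n$, let $I\subset\mathbb R$ be an open interval, let $\lambda\in C^2(I)$ satisfy $\lambda>0$ and $\lambda'>0$, and let $\overline M=I\times M$ carry the warped product metric $\bar g=dr^2+\lambda^2(r)g'$. Put $\zeta=\lambda'/\lambda$. Let $r_1<r_2$ be points of $I$ and let $\phi:I\to\mathbb R$ be a differentiable function with $\phi>0$, $\phi'<0$, $\phi(r)\ge 1$ for $r\le r_1$ and $\phi(r)\le 1$ for $r\ge r_2$. Let $f=f(r,u,\nu)$ be a given real function on the tangent vectors of $\overline M$, and for $0\le t\le 1$ put $$f^t(r,u,\nu)=t\,f(r,u,\nu)+(1-t)\,\phi(r)\,\frac{C_n^k}{C_n^l}\big((n-1)\zeta(r)\big)^{k-l}.$$ For a star-shaped hypersurface $\Sigma=\{(r(u),u): u\in M\}\subset\overline M$, with $r:M\to I$ of class $C^2$, let $\nu$ be the outer unit normal (the unit normal with $\langle\nu,\partial_r\rangle>0$), let $g$ be the induced metric, $h(X,Y)=-\langle\overline\nabla_XY,\nu\rangle$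 the second fundamental form, $H=\operatorname{tr}(g^{-1}h)$, $\eta=Hg-h$, and let $\mu(\eta)\in\mathbb R^n$ be the eigenvalues of $g^{-1}\eta$. The hypersurface is called $(\eta,k)$-convex if $\sigma_j(\mu(\eta))>0$ everywhere on $\Sigma$ for all $1\le j\le k$, where $\sigma_j$ is the $j$-th elementary symmetric function. Then the equation $\phi(r_0)=1$ has exactly one solution $r_0\in I$, and the homotopy equation $$\frac{\sigma_k(\mu(\eta))}{\sigma_l(\mu(\eta))}=f^t(r,u,\nu)$$ at $t=0$ has exactly one $(\eta,k)$-convex solution $\Sigma$ among the star-shaped hypersurfaces, namely the slice $\Sigma_0=\{(r,u)\in\overline M: r=r_0\}$, that is, $r(u)\equiv r_0$. -/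

import Mathlib

open scoped Manifold ContDiff

noncomputable section

namespace WarpedProduct

/-- The `n`-dimensional Euclidean model space of the base manifold. -/
abbrev Model (n : ℕ) : Type := EuclideanSpace ℝ (Fin n)

/-! ### Local Riemannian geometry of hypersurfaces

`W` is a coordinate space carrying a metric `G q X Y` (base point `q`, vectors `X`, `Y`). -/

section Local

variable {E W : Type*} [NormedAddCommGroup E] [NormedSpace ℝ E]
  [NormedAddCommGroup W] [NormedSpace ℝ W]

/-- `G(∇_X Y, Z)` at `p` for the Levi-Civita connection of `G` and constant coordinate fields
`X`, `Y`, `Z`, by the Koszul formula (Christoffel symbols of the first kind). -/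
def christoffel (G : W → W → W → ℝ) (p X Y Z : W) : ℝ :=
  (1 / 2) * (fderiv ℝ (fun q => G q Y Z) p X + fderiv ℝ (fun q => G q X Z) p Y
    - fderiv ℝ (fun q => G q X Y) p Z)

/-- First fundamental form of the parametrised hypersurface `F` at the parameter `x`. -/
def firstFundamental (G : W → W → W → ℝ) (F : E → W) (x a b : E) : ℝ :=
  G (F x) (fderiv ℝ F x a) (fderiv ℝ F x b)

/-- Second fundamental form `h(a, b) = -G(∇_{F_* a} F_* b, ν)` of the parametrised hypersurface
`F` at the parameter `x`, with respect to the unit normal `ν`. -/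
def secondFundamental (G : W → W → W → ℝ) (F : E → W) (x : E) (ν : W) (a b : E) : ℝ :=
  -(G (F x) (fderiv ℝ (fun y => fderiv ℝ F y b) x a) ν
    + christoffel G (F x) (fderiv ℝ F x a) (fderiv ℝ F x b) ν)

end Local

/-- Matrix of a form on the model space in the standard coordinate basis. -/
def formMatrix {n : ℕ} (B : Model n → Model n → ℝ) : Matrix (Fin n) (Fin n) ℝ :=
  Matrix.of fun i j => B (EuclideanSpace.single i 1) (EuclideanSpace.single j 1)

/-- The endomorphism `g⁻¹ η`, where `η = H g - h` and `H = tr (g⁻¹ h)`. -/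
def etaMatrix {n : ℕ} (g h : Matrix (Fin n) (Fin n) ℝ) : Matrix (Fin n) (Fin n) ℝ :=
  g⁻¹ * ((g⁻¹ * h).trace • g - h)

/-- `σ_j` of the eigenvalues, counted with algebraic multiplicity. It is applied to `g⁻¹ η` with
`g` positive definite and `η` symmetric, so that all `n` eigenvalues are real. -/
def sigma {n : ℕ} (j : ℕ) (A : Matrix (Fin n) (Fin n) ℝ) : ℝ :=
  A.charpoly.roots.esymm j

/-! ### Radial graphs in a warped product -/

section Warped

variable {n : ℕ} {M : Type*} [TopologicalSpace M] [ChartedSpace (Model n) M]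
  [IsManifold (𝓡 n) ∞ M]

/-- A smooth Riemannian metric on `M`. -/
abbrev Metric (n : ℕ) (M : Type*) [TopologicalSpace M] [ChartedSpace (Model n) M]
    [IsManifold (𝓡 n) ∞ M] :=
  Bundle.ContMDiffRiemannianMetric (𝓡 n) ∞ (Model n) (fun u : M => TangentSpace (𝓡 n) u)

/-- Coordinate expression at `x` of the metric `g'` of `M` in the chart around `u`. -/
def baseMetric (g' : Metric n M) (u : M) (x a b : Model n) : ℝ :=
  g'.inner ((extChartAt (𝓡 n) u).symm x)
    (mfderiv 𝓘(ℝ, Model n) (𝓡 n) (extChartAt (𝓡 n) u).symm x a)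
    (mfderiv 𝓘(ℝ, Model n) (𝓡 n) (extChartAt (𝓡 n) u).symm x b)

/-- The warped product metric `dr² + lam(r)² g'` in the coordinates `(r, x)`, where `x` is the
chart of `M` around `u`. -/
def warpedMetric (g' : Metric n M) (lam : ℝ → ℝ) (u : M) (q X Y : ℝ × Model n) : ℝ :=
  X.1 * Y.1 + lam q.1 ^ 2 * baseMetric g' u q.2 X.2 Y.2

/-- The radial graph of `r` in the same coordinates: `x ↦ (r, x)`. -/
def graphParam (r : M → ℝ) (u : M) (x : Model n) : ℝ × Model n :=
  (r ((extChartAt (𝓡 n) u).symm x), x)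

/-- A tangent vector of `ℝ × M` at a point over `u`. Mathlib's `TangentSpace (𝓡 n) u` is the model
space, a vector being identified with its coordinates in the chart around `u`. -/
abbrev Tangent (n : ℕ) {M : Type*} [TopologicalSpace M] [ChartedSpace (Model n) M]
    (u : M) : Type := ℝ × TangentSpace (𝓡 n) u

/-- `ν` is the outer unit normal of the radial graph of `r` at the point `(r u, u)`. -/
structure IsOuterUnitNormal (g' : Metric n M) (lam : ℝ → ℝ) (r : M → ℝ) (u : M)
    (ν : Tangent n u) : Prop where
  unit : warpedMetric g' lam u (r u, extChartAt (𝓡 n) u u) ν ν = 1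
  normal : ∀ a : Model n, warpedMetric g' lam u (r u, extChartAt (𝓡 n) u u) ν
    (fderiv ℝ (graphParam r u) (extChartAt (𝓡 n) u u) a) = 0
  outer : 0 < warpedMetric g' lam u (r u, extChartAt (𝓡 n) u u) ν ((1 : ℝ), (0 : Model n))

/-- The endomorphism `g⁻¹ η` of the radial graph of `r` with normal `ν`, at the point over `u`,
as a matrix in the coordinates of the chart around `u`. -/
def graphEta (g' : Metric n M) (lam : ℝ → ℝ) (r : M → ℝ) (u : M) (ν : Tangent n u) :
    Matrix (Fin n) (Fin n) ℝ :=
  etaMatrix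
    (formMatrix (firstFundamental (warpedMetric g' lam u) (graphParam r u)
      (extChartAt (𝓡 n) u u)))
    (formMatrix (secondFundamental (warpedMetric g' lam u) (graphParam r u)
      (extChartAt (𝓡 n) u u) ν))

/-- `(η, k)`-convexity: the eigenvalues of `g⁻¹ η` lie in the Gårding cone `Γ_k` everywhere. -/
def IsEtaConvex (k : ℕ) (g' : Metric n M) (lam : ℝ → ℝ) (r : M → ℝ)
    (ν : ∀ u : M, Tangent n u) : Prop :=
  ∀ u, ∀ j, 1 ≤ j → j ≤ k → 0 < sigma j (graphEta g' lam r u (ν u))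

/-- `(C_n^k / C_n^l) ((n - 1) ζ(s))^(k - l)` with `ζ = lam' / lam`. -/
def sliceValue (n k l : ℕ) (lam : ℝ → ℝ) (s : ℝ) : ℝ :=
  (n.choose k : ℝ) / (n.choose l : ℝ) * (((n : ℝ) - 1) * (deriv lam s / lam s)) ^ (k - l)

/-- The right-hand side `f^t = t f + (1 - t) φ(r) (C_n^k / C_n^l) ((n - 1) ζ(r))^(k - l)`. -/
def homotopyRHS (k l : ℕ) (lam φ : ℝ → ℝ) (f : ∀ p : ℝ × M, Tangent n p.2 → ℝ) (t : ℝ)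
    (p : ℝ × M) (ν : Tangent n p.2) : ℝ :=
  t * f p ν + (1 - t) * (φ p.1 * sliceValue n k l lam p.1)

/-- `S` is an `(η, k)`-convex solution of the homotopy equation at time `t`: a star-shaped
hypersurface, i.e. the graph of a `C²` function `r : M → J`, which with its outer unit normal field
`ν` is `(η, k)`-convex and satisfies `(σ_k / σ_l)(μ(η)) = f^t`. -/
def IsConvexSolution (k l : ℕ) (g' : Metric n M) (J : Set ℝ) (lam φ : ℝ → ℝ)
    (f : ∀ p : ℝ × M, Tangent n p.2 → ℝ) (t : ℝ) (S : Set (ℝ × M)) : Prop :=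
  ∃ r : M → ℝ, ContMDiff (𝓡 n) 𝓘(ℝ, ℝ) 2 r ∧ (∀ u, r u ∈ J) ∧ S = {p | p.1 = r p.2} ∧
    ∃ ν : ∀ u : M, Tangent n u, (∀ u, IsOuterUnitNormal g' lam r u (ν u)) ∧
      IsEtaConvex k g' lam r ν ∧
      ∀ u, sigma k (graphEta g' lam r u (ν u)) / sigma l (graphEta g' lam r u (ν u))
        = homotopyRHS k l lam φ f t (r u, u) (ν u)

end Warped

end WarpedProduct

end

/-! ### Elementary symmetric functions of real multisets -/

namespace Multiset

/-! Since `φ` is continuous and strictly decreasing on the interval, the intermediate value theorem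
gives a unique `r₀` with `φ r₀ = 1`. On a slice all `μ_i` equal `(n - 1)ζ`, so the slice at `r₀`
solves the equation at `t = 0`.

Uniqueness is a maximum principle. At a critical point of `r` the outer normal is `∂_r`, `g = λ²g'`
and `h = λλ'g' - D²r`. Hence each principal curvature is `κ_i = ζ - D²r(v, v)` for some `g`-unit
vector `v`, and `μ_i = ∑ κ_j - κ_i`. At a maximum `κ_i ≥ ζ`, so every `μ_i ≥ (n - 1)ζ > 0`, and
`σ_k/σ_l` is at least its slice value (`le_esymm_div_esymm`). The equation then gives `φ ≥ 1`, that
is `r ≤ r₀`. At a minimum `κ_i ≤ ζ`, but the `μ_i` may have either sign. There `(η, k)`-convexity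
and the bound on `∑ μ_i` suffice: the Maclaurin inequality `p_{j+1} ≤ p_1 p_j` in the Gårding cone
bounds `σ_k/σ_l` above by the slice value (`esymm_div_esymm_le`), so `φ ≤ 1` and `r ≥ r₀`. Thus `r`
is constant.

The Maclaurin inequality is reduced by repeated differentiation of `∏ (X + x_i)` to the
arithmetic-harmonic mean inequality for positive numbers. -/

theorem esymm_cons_succ {R : Type*} [CommSemiring R] (a : R) (s : Multiset R) (j : ℕ) :
    (a ::ₘ s).esymm (j + 1) = s.esymm (j + 1) + a * s.esymm j := by
  simp [esymm, powersetCard_cons, map_map, sum_map_mul_left]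

theorem esymm_zero_right {R : Type*} [CommSemiring R] (s : Multiset R) : s.esymm 0 = 1 := by
  simp [esymm]

theorem esymm_one_right {R : Type*} [CommSemiring R] (s : Multiset R) : s.esymm 1 = s.sum := by
  simp [esymm, powersetCard_one, map_map]

theorem esymm_zero_succ {R : Type*} [CommSemiring R] (j : ℕ) :
    (0 : Multiset R).esymm (j + 1) = 0 := by
  rw [esymm, powersetCard_eq_empty _ (by simp)]
  simp

theorem esymm_replicate {R : Type*} [CommSemiring R] (n j : ℕ) (c : R) :
    (replicate n c).esymm j = n.choose j * c ^ j := by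
  induction n generalizing j with
  | zero => cases j <;> simp [esymm_zero_succ, esymm_zero_right]
  | succ n ih =>
    cases j with
    | zero => simp [esymm_zero_right]
    | succ j =>
      rw [replicate_succ, esymm_cons_succ, ih, ih, Nat.choose_succ_succ]
      push_cast
      ring

theorem esymm_nonneg {s : Multiset ℝ} (hs : ∀ x ∈ s, 0 ≤ x) (j : ℕ) : 0 ≤ s.esymm j := by
  induction s using Multiset.induction_on generalizing j with
  | empty => cases j <;> simp [esymm_zero_succ, esymm_zero_right]
  | cons a s ih =>
    cases j with
    | zero => simp [esymm_zero_right]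
    | succ j =>
      rw [esymm_cons_succ]
      have ha := hs a (mem_cons_self a s)
      have := ih (fun x hx => hs x (mem_cons_of_mem hx))
      exact add_nonneg (this _) (mul_nonneg ha (this _))

theorem esymm_pos {s : Multiset ℝ} (hs : ∀ x ∈ s, 0 < x) {j : ℕ} (hj : j ≤ card s) :
    0 < s.esymm j := by
  induction s using Multiset.induction_on generalizing j with
  | empty =>
    obtain rfl : j = 0 := by simpa using hj
    simp [esymm_zero_right]
  | cons a s ih =>
    cases j with
    | zero => simp [esymm_zero_right]
    | succ j =>
      rw [esymm_cons_succ]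
      have ha := hs a (mem_cons_self a s)
      have hs' : ∀ x ∈ s, 0 < x := fun x hx => hs x (mem_cons_of_mem hx)
      have h1 := esymm_nonneg (fun x hx => (hs' x hx).le) (j + 1)
      have h2 := ih hs' (j := j) (by simpa using hj)
      positivity

/-- If all entries are at least `c ≥ 0`, consecutive elementary symmetric functions grow at least
as fast as those of the constant vector `c`. -/
theorem mul_esymm_le_of_forall_le {s : Multiset ℝ} {c : ℝ} (hc : 0 ≤ c) (hs : ∀ x ∈ s, c ≤ x)
    (j : ℕ) : c * ((card s : ℝ) - j) * s.esymm j ≤ (j + 1) * s.esymm (j + 1) := by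
  induction s using Multiset.induction_on generalizing j with
  | empty => cases j <;> simp [esymm_zero_succ, esymm_zero_right]
  | cons a s ih =>
    have ha := hs a (mem_cons_self a s)
    have hs' : ∀ x ∈ s, c ≤ x := fun x hx => hs x (mem_cons_of_mem hx)
    have ih := ih hs'
    have hn : ∀ i, 0 ≤ s.esymm i := esymm_nonneg fun x hx => hc.trans (hs' x hx)
    cases j with
    | zero =>
      have h0 := ih 0
      simp only [esymm_zero_right, esymm_cons_succ, card_cons] at h0 ⊢
      push_cast at h0 ⊢
      linarith
    | succ j =>
      -- After expanding by `esymm_cons_succ`, the claim is the sum of the hypothesis at `j + 1`,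
      -- `a` times the hypothesis at `j`, and `c σ_{j+1} ≤ a σ_{j+1}`.
      have h1 := ih (j + 1)
      have h2 := mul_le_mul_of_nonneg_left (ih j) (hc.trans ha)
      have h3 := mul_le_mul_of_nonneg_right ha (hn (j + 1))
      simp only [esymm_cons_succ, card_cons]
      push_cast at h1 h2 ⊢
      linarith

/-- The inequality between the arithmetic and the harmonic mean of positive numbers. -/
theorem sq_mul_esymm_card_le {s : Multiset ℝ} (hs : ∀ x ∈ s, 0 < x) {m : ℕ}
    (hm : card s = m + 1) :
    ((m : ℝ) + 1) ^ 2 * s.esymm (m + 1) ≤ s.esymm 1 * s.esymm m := by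
  induction s using Multiset.induction_on generalizing m with
  | empty => simp at hm
  | cons a s ih =>
    have ha := hs a (mem_cons_self a s)
    have hs' : ∀ x ∈ s, 0 < x := fun x hx => hs x (mem_cons_of_mem hx)
    obtain rfl : card s = m := by simpa using hm
    rcases hcard : card s with _ | m
    · simp [esymm_zero_right]
    · have h := ih hs' hcard
      have hS := esymm_pos hs' (j := 1) (by lia)
      have hE := esymm_pos hs' (j := m + 1) hcard.ge
      have hF := esymm_pos hs' (j := m) (by lia)
      have h0 : s.esymm (m + 1 + 1) = 0 := by
        rw [esymm, powersetCard_eq_empty _ (by lia)]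
        simp
      rw [esymm_cons_succ, h0, esymm_cons_succ a s m, esymm_cons_succ a s 0, esymm_zero_right]
      simp only [zero_add]
      generalize s.esymm 1 = S at *
      generalize s.esymm (m + 1) = E at *
      generalize s.esymm m = F at *
      push_cast
      -- Times `F`, the induction hypothesis `(m + 1)² E ≤ S F` bounds the expression below by the
      -- square `(aF - (m + 1)E)²`.
      have key : 0 ≤ a ^ 2 * F + S * E - 2 * ((m : ℝ) + 1) * a * E := by
        refine nonneg_of_mul_nonneg_right ?_ hF
        have := mul_le_mul_of_nonneg_right h hE.le
        nlinarith [sq_nonneg (a * F - ((m : ℝ) + 1) * E)]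
      nlinarith [mul_le_mul_of_nonneg_left h ha.le]

end Multiset

/-! ### Real roots of derivatives -/

namespace Polynomial

/-- By Rolle, each differentiation loses at most one real root with multiplicity. Hence derivatives
of a real-rooted polynomial stay real-rooted. -/
theorem card_roots_le_iterate_derivative (p : ℝ[X]) (d : ℕ) :
    Multiset.card p.roots ≤ Multiset.card (derivative^[d] p).roots + d := by
  induction d with
  | zero => simp
  | succ d ih =>
    rw [Function.iterate_succ_apply']
    have := card_roots_le_derivative (derivative^[d] p)
    lia

/-- At `x ≥ 0` no term is negative and the constant term is positive. -/
theorem neg_of_isRoot_of_coeff_pos {p : ℝ[X]} (hp : ∀ i ≤ p.natDegree, 0 < p.coeff i) {x : ℝ}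
    (hx : p.IsRoot x) : x < 0 := by
  by_contra! h
  have : 0 < p.eval x := by
    rw [eval_eq_sum_range, Finset.sum_range_succ']
    have h0 := hp 0 (Nat.zero_le _)
    have : 0 ≤ ∑ k ∈ Finset.range p.natDegree, p.coeff (k + 1) * x ^ (k + 1) :=
      Finset.sum_nonneg fun k hk =>
        mul_nonneg (hp _ (by simpa using hk)).le (by positivity)
    simpa using add_pos_of_nonneg_of_pos this h0
  exact this.ne' hx

end Polynomial

/-! ### Bounds for quotients of elementary symmetric functions -/

namespace Multiset

open Polynomial

/-- The Maclaurin type inequality `p_{m+1} ≤ p_1 p_m` for the normalised elementary symmetric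
functions `p_j` in the Gårding cone `Γ_{m+1}`. -/
theorem mul_esymm_succ_le_of_esymm_pos {s : Multiset ℝ} {m : ℕ} (hm : m + 1 ≤ card s)
    (hs : ∀ j, 1 ≤ j → j ≤ m + 1 → 0 < s.esymm j) :
    (card s : ℝ) * ((m + 1) * s.esymm (m + 1)) ≤
      ((card s : ℝ) - m) * (s.esymm 1 * s.esymm m) := by
  obtain ⟨d, hd⟩ := Nat.exists_eq_add_of_le hm
  -- With `d = n - (m + 1)`, the derivative `Q` has degree `m + 1`, and its coefficients are
  -- positive multiples of `σ_0, …, σ_{m+1}`: the higher functions, of unknown sign, have been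
  -- differentiated away.
  set P : ℝ[X] := (s.map fun x => X + C x).prod
  set Q := derivative^[d] P
  have hs0 : ∀ j ≤ m + 1, 0 < s.esymm j := fun j hj => by
    rcases j with _ | j
    · simp [esymm_zero_right]
    · exact hs _ (by lia) hj
  have hP : P = ((s.map Neg.neg).map fun x => X - C x).prod := by simp [P, map_map]
  have hPdeg : P.natDegree = card s := by
    rw [hP, natDegree_multiset_prod_X_sub_C_eq_card, card_map]
  have hProots : card P.roots = card s := by
    rw [hP, roots_multiset_prod_X_sub_C, card_map]
  have hcoeff : ∀ i ≤ m + 1,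
      Q.coeff i = ((i + d).descFactorial d : ℝ) * s.esymm (m + 1 - i) := fun i hi => by
    rw [coeff_iterate_derivative, prod_X_add_C_coeff s (by lia), nsmul_eq_mul]
    congr 2
    lia
  have hQpos : ∀ i ≤ m + 1, 0 < Q.coeff i := fun i hi => by
    rw [hcoeff i hi]
    have : 0 < (i + d).descFactorial d := Nat.descFactorial_pos.2 (by lia)
    have := hs0 (m + 1 - i) (by lia)
    positivity
  have hQdeg : Q.natDegree = m + 1 := by
    refine le_antisymm ?_ (le_natDegree_of_ne_zero (hQpos _ le_rfl).ne')
    have := natDegree_iterate_derivative P d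
    simp only [Q]
    lia
  have hQroots : card Q.roots = Q.natDegree := by
    refine le_antisymm (card_roots' Q) ?_
    have := card_roots_le_iterate_derivative P d
    simp only [Q] at hQdeg ⊢
    lia
  -- `Q` is real-rooted with positive coefficients, so the negated roots are `m + 1` positive
  -- numbers, to which the arithmetic-harmonic mean inequality applies.
  set t := Q.roots.map Neg.neg
  have ht : ∀ x ∈ t, 0 < x := by
    intro x hx
    obtain ⟨y, hy, rfl⟩ := mem_map.1 hx
    have := neg_of_isRoot_of_coeff_pos (by rwa [hQdeg]) (isRoot_of_mem_roots hy)
    linarith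
  have htcard : card t = m + 1 := by rw [card_map, hQroots, hQdeg]
  have hvieta : ∀ i ≤ m + 1, ((i + d).descFactorial d : ℝ) * s.esymm (m + 1 - i)
      = Q.leadingCoeff * t.esymm (m + 1 - i) := fun i hi => by
    rw [← hcoeff i hi, coeff_eq_esymm_roots_of_card hQroots (by lia), hQdeg, esymm_neg]
    ring
  have hlead : Q.leadingCoeff = ((m + 1 + d).descFactorial d : ℝ) := by
    rw [leadingCoeff, hQdeg, hcoeff _ le_rfl]
    simp [esymm_zero_right]
  have h0 := hvieta 0 (by lia)
  have h1 := hvieta 1 (by lia)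
  have h2 := hvieta m (by lia)
  rw [hlead] at h0 h1 h2
  have hAH := sq_mul_esymm_card_le ht htcard
  -- The ratios `e1` and `e2` of falling factorials turn the constant `(m + 1)²` for `t` into `n(m +
  -- 1)/(n - m)` for `s`.
  have e1 : ((1 + d).descFactorial d : ℝ) = (d + 1) * (d.descFactorial d : ℝ) := by
    have := Nat.succ_descFactorial d d
    rw [add_comm 1 d]
    have h : d + 1 - d = 1 := by lia
    rw [h, one_mul] at this
    exact_mod_cast this
  have e2 : ((m : ℝ) + 1) * ((m + 1 + d).descFactorial d : ℝ)
      = (m + d + 1) * ((m + d).descFactorial d : ℝ) := by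
    have := Nat.succ_descFactorial (m + d) d
    have h : m + d + 1 - d = m + 1 := by lia
    rw [h] at this
    rw [show m + 1 + d = m + d + 1 by lia]
    exact_mod_cast this
  have hD0 : (0 : ℝ) < d.descFactorial d := by
    exact_mod_cast Nat.descFactorial_pos.2 le_rfl
  have hDm : (0 : ℝ) < (m + d).descFactorial d := by
    exact_mod_cast Nat.descFactorial_pos.2 (by lia)
  have hDm1 : (0 : ℝ) < (m + 1 + d).descFactorial d := by
    exact_mod_cast Nat.descFactorial_pos.2 (by lia)
  have hcard : (card s : ℝ) = m + d + 1 := by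
    rw [hd]
    push_cast
    ring
  rw [e1] at h1
  simp only [zero_add, Nat.sub_zero, Nat.add_sub_cancel, Nat.add_sub_cancel_left] at h0 h1 h2
  rw [hcard]
  generalize ((m + 1 + d).descFactorial d : ℝ) = L at *
  generalize ((m + d).descFactorial d : ℝ) = K at *
  generalize (d.descFactorial d : ℝ) = D at *
  have hK : L ^ 2 * (((m : ℝ) + 1) ^ 2 * t.esymm (m + 1)) ≤ L ^ 2 * (t.esymm 1 * t.esymm m) := by
    gcongr
  have h3 : ((m : ℝ) + 1) ^ 2 * L * (D * s.esymm (m + 1)) ≤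
      (K * s.esymm 1) * ((d + 1) * D * s.esymm m) := by
    have h2' : K * s.esymm 1 = L * t.esymm 1 := by
      simpa [show m + 1 - m = 1 by lia] using h2
    rw [h0, h1, h2']
    linarith
  have h4 : (D * K) * ((m + d + 1) * ((m + 1) * s.esymm (m + 1))) ≤
      (D * K) * ((m + d + 1 - m) * (s.esymm 1 * s.esymm m)) := by
    have : (D * K) * ((m + d + 1) * ((m + 1) * s.esymm (m + 1)))
        = ((m : ℝ) + 1) ^ 2 * L * (D * s.esymm (m + 1)) := by
      linear_combination (-(D * ((m : ℝ) + 1) * s.esymm (m + 1))) * e2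
    rw [this]
    linarith
  exact le_of_mul_le_mul_left h4 (by positivity)

/-- A quotient of elementary symmetric functions of numbers bounded below by `c > 0` is at least
its value at the constant vector `c`. -/
theorem le_esymm_div_esymm {s : Multiset ℝ} {c : ℝ} (hc : 0 < c) (hs : ∀ x ∈ s, c ≤ x)
    {k l : ℕ} (hlk : l ≤ k) (hk : k ≤ card s) :
    ((card s).choose k : ℝ) / (card s).choose l * c ^ (k - l) ≤ s.esymm k / s.esymm l := by
  have hpos : ∀ j ≤ card s, 0 < s.esymm j :=
    fun j hj => esymm_pos (fun x hx => hc.trans_le (hs x hx)) hj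
  have hl := hpos l (hlk.trans hk)
  have hC : ∀ j ≤ card s, (0 : ℝ) < (card s).choose j :=
    fun j hj => by exact_mod_cast Nat.choose_pos hj
  -- Each step multiplies in `σ_{k+1}/σ_k ≥ c (n - k)/(k + 1)`, whose right side is `c` times the
  -- ratio of consecutive binomials.
  induction k, hlk using Nat.le_induction with
  | base => simp [hl.ne', (hC l hk).ne']
  | succ k hlk ih =>
    have ih := ih (by lia)
    have h := mul_esymm_le_of_forall_le hc.le hs k
    have hCk : ((card s).choose (k + 1) : ℝ) * (k + 1) = (card s).choose k * (card s - k) := by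
      have := Nat.choose_succ_right_eq (card s) k
      have hk' : k ≤ card s := by lia
      rw [← Nat.cast_sub hk']
      exact_mod_cast this
    have hCl := hC l (by lia)
    rw [div_mul_eq_mul_div, div_le_div_iff₀ hCl hl] at ih ⊢
    rw [Nat.sub_add_comm hlk, pow_succ]
    have hnk : (0 : ℝ) ≤ card s - k := by
      rw [sub_nonneg]
      exact_mod_cast (by lia : k ≤ card s)
    have h1 := mul_le_mul_of_nonneg_left ih (mul_nonneg hc.le hnk)
    have h2 := mul_le_mul_of_nonneg_right h hCl.le
    refine le_of_mul_le_mul_left ?_ (by positivity : (0 : ℝ) < k + 1)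
    linear_combination h1 + h2 + c ^ (k - l) * c * s.esymm l * hCk

/-- A quotient of elementary symmetric functions in the Gårding cone is at most its value at the
constant vector `c`, if `c` bounds the mean. -/
theorem esymm_div_esymm_le {s : Multiset ℝ} {c : ℝ} (hc : 0 < c) (hsum : s.sum ≤ card s * c)
    {k l : ℕ} (hlk : l ≤ k) (hk : k ≤ card s) (hs : ∀ j, 1 ≤ j → j ≤ k → 0 < s.esymm j) :
    s.esymm k / s.esymm l ≤ ((card s).choose k : ℝ) / (card s).choose l * c ^ (k - l) := by
  have hpos : ∀ j ≤ k, 0 < s.esymm j := fun j hj => by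
    rcases j with _ | j
    · simp [esymm_zero_right]
    · exact hs _ (by lia) hj
  have hl := hpos l hlk
  have hC : ∀ j ≤ card s, (0 : ℝ) < (card s).choose j :=
    fun j hj => by exact_mod_cast Nat.choose_pos hj
  induction k, hlk using Nat.le_induction with
  | base => simp [hl.ne', (hC l hk).ne']
  | succ k hlk ih =>
    have ih := ih (by lia) (fun j h1 h2 => hs j h1 (by lia)) (fun j hj => hpos j (by lia))
    have hnk : (0 : ℝ) ≤ card s - k := by
      rw [sub_nonneg]
      exact_mod_cast (by lia : k ≤ card s)
    have hcard : (0 : ℝ) < card s := by exact_mod_cast (by lia : 0 < card s)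
    -- This is `p_{k+1} ≤ p_1 p_k` combined with `p_1 ≤ c`.
    have h : (k + 1) * s.esymm (k + 1) ≤ c * (card s - k) * s.esymm k := by
      have h1 := mul_esymm_succ_le_of_esymm_pos hk hs
      rw [esymm_one_right] at h1
      have h2 := mul_le_mul_of_nonneg_left hsum (mul_nonneg hnk (hpos k (by lia)).le)
      refine le_of_mul_le_mul_left ?_ hcard
      linarith
    have hCk : ((card s).choose (k + 1) : ℝ) * (k + 1) = (card s).choose k * (card s - k) := by
      have := Nat.choose_succ_right_eq (card s) k
      have hk' : k ≤ card s := by lia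
      rw [← Nat.cast_sub hk']
      exact_mod_cast this
    have hCl := hC l (by lia)
    rw [div_mul_eq_mul_div, div_le_div_iff₀ hl hCl] at ih ⊢
    rw [Nat.sub_add_comm hlk, pow_succ]
    have h1 := mul_le_mul_of_nonneg_left ih (mul_nonneg hc.le hnk)
    have h2 := mul_le_mul_of_nonneg_right h hCl.le
    refine le_of_mul_le_mul_left ?_ (by positivity : (0 : ℝ) < k + 1)
    linear_combination h1 + h2 - c ^ (k - l) * c * s.esymm l * hCk

end Multiset

/-! ### Simultaneous diagonalisation -/

namespace Matrix

open Matrix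

/-- Factor `g = BᵀB` and let the orthogonal `U` diagonalise the symmetric matrix `B⁻ᵀ h B⁻¹`; then
`T = B⁻¹U`. Its columns are `g`-orthonormal principal directions. -/
theorem PosDef.exists_simultaneous_diagonalization {n : Type*} [Fintype n] [DecidableEq n]
    {g h : Matrix n n ℝ} (hg : g.PosDef) (hh : hᵀ = h) :
    ∃ (T : Matrix n n ℝ) (κ : n → ℝ), IsUnit T ∧ Tᵀ * g * T = 1 ∧ Tᵀ * h * T = diagonal κ := by
  obtain ⟨B, hB, rfl⟩ : ∃ B : Matrix n n ℝ, IsUnit B ∧ g = Bᵀ * B := by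
    open scoped MatrixOrder in
    obtain ⟨B, hB, h⟩ := CStarAlgebra.isStrictlyPositive_iff_eq_star_mul_self.mp
      hg.isStrictlyPositive
    exact ⟨B, hB, by simpa [star_eq_conjTranspose] using h⟩
  have hB' := (isUnit_iff_isUnit_det B).1 hB
  have hS : (B⁻¹ᵀ * h * B⁻¹).IsHermitian := by
    rw [IsHermitian, conjTranspose_eq_transpose_of_trivial]
    simp [transpose_mul, hh, Matrix.mul_assoc]
  set U : Matrix n n ℝ := hS.eigenvectorUnitary.1
  have hU : Uᵀ * U = 1 := by
    have := Unitary.coe_star_mul_self hS.eigenvectorUnitary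
    simpa [star_eq_conjTranspose] using this
  refine ⟨B⁻¹ * U, hS.eigenvalues, ?_, ?_, ?_⟩
  · refine IsUnit.mul ?_ (IsUnit.of_mul_eq_one_right _ hU)
    exact (isUnit_nonsing_inv_iff).2 hB
  · calc (B⁻¹ * U)ᵀ * (Bᵀ * B) * (B⁻¹ * U)
        = Uᵀ * ((B * B⁻¹)ᵀ * (B * B⁻¹)) * U := by simp only [transpose_mul, Matrix.mul_assoc]
      _ = 1 := by simp [mul_nonsing_inv _ hB', hU]
  · have := hS.conjStarAlgAut_star_eigenvectorUnitary
    rw [Unitary.conjStarAlgAut_star_apply] at this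
    simp only [star_eq_conjTranspose, conjTranspose_eq_transpose_of_trivial] at this
    calc (B⁻¹ * U)ᵀ * h * (B⁻¹ * U)
        = Uᵀ * (B⁻¹ᵀ * h * B⁻¹) * U := by simp only [transpose_mul, Matrix.mul_assoc]
      _ = _ := this

end Matrix

/-! ### Eigenvalues of `g⁻¹η` -/

namespace WarpedProduct

open Matrix

/-- Eigenvalues of `g⁻¹ η` in terms of the principal curvatures `κ`. -/
theorem exists_roots_charpoly_etaMatrix {n : ℕ} {g h : Matrix (Fin n) (Fin n) ℝ} (hg : g.PosDef)
    (hh : hᵀ = h) : ∃ κ : Fin n → ℝ,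
      (etaMatrix g h).charpoly.roots = Finset.univ.val.map (fun i => ∑ j, κ j - κ i) ∧
      ∀ i, ∃ v : Fin n → ℝ, v ⬝ᵥ g *ᵥ v = 1 ∧ v ⬝ᵥ h *ᵥ v = κ i := by
  obtain ⟨T, κ, hT, h1, h2⟩ := hg.exists_simultaneous_diagonalization hh
  have hT' := (isUnit_iff_isUnit_det T).1 hT
  have hginv : g⁻¹ = T * Tᵀ := by
    refine inv_eq_left_inv ?_
    have h3 : T * (Tᵀ * g * T) * T⁻¹ = 1 := by rw [h1, Matrix.mul_one, mul_nonsing_inv _ hT']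
    rw [← h3]
    simp only [Matrix.mul_assoc, mul_nonsing_inv _ hT', Matrix.mul_one]
  have hgh : g⁻¹ * h = T * diagonal κ * T⁻¹ := by
    rw [← h2, hginv]
    simp only [Matrix.mul_assoc, mul_nonsing_inv _ hT', Matrix.mul_one]
  have htr : (g⁻¹ * h).trace = ∑ j, κ j := by
    rw [hgh, Matrix.trace_mul_comm, ← Matrix.mul_assoc, nonsing_inv_mul _ hT', Matrix.one_mul,
      trace_diagonal]
  have heta : etaMatrix g h = T * diagonal (fun i => ∑ j, κ j - κ i) * T⁻¹ := by
    have hgu : IsUnit g.det := isUnit_iff_ne_zero.2 hg.det_pos.ne'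
    rw [etaMatrix, Matrix.mul_sub, Matrix.mul_smul, nonsing_inv_mul _ hgu, htr, hgh]
    have : diagonal (fun i => ∑ j, κ j - κ i) = (∑ j, κ j) • (1 : Matrix (Fin n) (Fin n) ℝ)
        - diagonal κ := by
      ext i j
      by_cases hij : i = j
      · subst hij; simp
      · simp [hij]
    rw [this, Matrix.mul_sub, Matrix.sub_mul, Matrix.mul_smul, Matrix.mul_one, Matrix.smul_mul,
      mul_nonsing_inv _ hT']
  -- The vector attached to `κ i` is the `i`-th column of `T`.
  refine ⟨κ, ?_, fun i => ⟨T *ᵥ Pi.single i 1, ?_, ?_⟩⟩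
  · have hconj : (etaMatrix g h).charpoly = (diagonal (fun i => ∑ j, κ j - κ i)).charpoly := by
      have := charpoly_units_conj hT.unit (diagonal (fun i => ∑ j, κ j - κ i))
      rw [heta, ← this]
      simp
    rw [hconj]
    generalize (fun i => ∑ j, κ j - κ i) = μ
    rw [charpoly_diagonal, Polynomial.roots_prod]
    · simp
    · simp [Finset.prod_ne_zero_iff, Polynomial.X_sub_C_ne_zero]
  all_goals
    rw [mulVec_mulVec, dotProduct_mulVec, ← vecMul_transpose, vecMul_vecMul, ← Matrix.mul_assoc]
  · rw [h1]; simp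
  · rw [h2]; simp

end WarpedProduct

/-! ### The second derivative test -/

/-- At a local maximum the Hessian is negative semidefinite. -/
theorem IsLocalMax.fderiv_fderiv_apply_nonpos {E : Type*} [NormedAddCommGroup E] [NormedSpace ℝ E]
    {ρ : E → ℝ} {x : E} (hx : IsLocalMax ρ x) (hρ : ContDiffAt ℝ 2 ρ x) (a : E) :
    fderiv ℝ (fderiv ℝ ρ) x a a ≤ 0 := by
  by_contra! hpos
  set γ : ℝ → E := fun t => x + t • a
  have hγ : ∀ t, HasDerivAt γ a t := fun t => by
    simpa only [one_smul] using ((hasDerivAt_id' t).smul_const a).const_add x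
  have hγ0 : γ 0 = x := by simp [γ]
  have hγc : ContinuousAt γ 0 := (hγ 0).continuousAt
  have hdiff : ∀ᶠ y in nhds x, DifferentiableAt ℝ ρ y :=
    (hρ.eventually (by simp)).mono fun y hy => hy.differentiableAt (by norm_num)
  have hderiv : deriv (ρ ∘ γ) =ᶠ[nhds 0] fun t => fderiv ℝ ρ (γ t) a := by
    have : ∀ᶠ t in nhds (0 : ℝ), DifferentiableAt ℝ ρ (γ t) :=
      hγc.eventually (by rwa [hγ0])
    filter_upwards [this] with t ht
    exact (ht.hasFDerivAt.comp_hasDerivAt t (hγ t)).deriv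
  have hD : DifferentiableAt ℝ (fderiv ℝ ρ) x :=
    (hρ.fderiv_right (m := 1) (by norm_num)).differentiableAt (by norm_num)
  have hderiv2 : deriv (deriv (ρ ∘ γ)) 0 = fderiv ℝ (fderiv ℝ ρ) x a a := by
    rw [hderiv.deriv_eq]
    have hD' : HasFDerivAt (fderiv ℝ ρ) (fderiv ℝ (fderiv ℝ ρ) x) (γ 0) := by
      rw [hγ0]
      exact hD.hasFDerivAt
    have := (hD'.comp_hasDerivAt 0 (hγ 0)).clm_apply (hasDerivAt_const 0 a)
    simpa using this.deriv
  have hmax : IsLocalMax (ρ ∘ γ) 0 := by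
    have : ∀ᶠ y in nhds (γ 0), ρ y ≤ ρ x := by rwa [hγ0]
    simpa [IsLocalMax, IsMaxFilter, hγ0] using hγc.eventually this
  have hcont : ContinuousAt (ρ ∘ γ) 0 :=
    ContinuousAt.comp (by rw [hγ0]; exact hρ.continuousAt) hγc
  -- A positive second derivative would make `0` a local minimum as well, so `ρ ∘ γ` would be
  -- locally constant with zero second derivative.
  have hmin : IsLocalMin (ρ ∘ γ) 0 :=
    isLocalMin_of_deriv_deriv_pos (by rwa [hderiv2]) hmax.deriv_eq_zero hcont
  have hconst : ρ ∘ γ =ᶠ[nhds 0] fun _ => ρ (γ 0) := by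
    filter_upwards [hmax, hmin] with t h1 h2
    exact le_antisymm h1 h2
  have h1 : deriv (ρ ∘ γ) =ᶠ[nhds 0] fun _ => 0 := by
    simpa using hconst.deriv
  rw [← hderiv2, h1.deriv_eq] at hpos
  simp at hpos

/-- At a local minimum the Hessian is positive semidefinite. -/
theorem IsLocalMin.fderiv_fderiv_apply_nonneg {E : Type*} [NormedAddCommGroup E] [NormedSpace ℝ E]
    {ρ : E → ℝ} {x : E} (hx : IsLocalMin ρ x) (hρ : ContDiffAt ℝ 2 ρ x) (a : E) :
    0 ≤ fderiv ℝ (fderiv ℝ ρ) x a a := by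
  have h := hx.neg.fderiv_fderiv_apply_nonpos hρ.neg a
  have h1 : fderiv ℝ (fun y => -ρ y) = -fderiv ℝ ρ := by
    ext1 y
    exact fderiv_neg
  rw [h1, fderiv_neg] at h
  simpa using h

namespace WarpedProduct

open Matrix

/-! ### The base metric in a chart -/

section BaseMetric

variable {n : ℕ} {M : Type*} [TopologicalSpace M] [ChartedSpace (Model n) M]
  [IsManifold (𝓡 n) ∞ M]

theorem baseMetric_symm (g' : Metric n M) (u : M) (x a b : Model n) :
    baseMetric g' u x a b = baseMetric g' u x b a :=
  g'.symm _ _ _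

/-- Hides the varying tangent spaces: on the fixed model space, bilinearity becomes visible to
`simp`. -/
theorem exists_baseMetric_eq (g' : Metric n M) (u : M) (x : Model n) :
    ∃ (B : Model n →L[ℝ] Model n →L[ℝ] ℝ) (D : Model n →L[ℝ] Model n),
      ∀ a b, baseMetric g' u x a b = B (D a) (D b) :=
  ⟨g'.inner _, mfderiv 𝓘(ℝ, Model n) (𝓡 n) (extChartAt (𝓡 n) u).symm x, fun _ _ => rfl⟩

/-- The base metric in a chart as a bilinear map. -/
noncomputable def baseForm (g' : Metric n M) (u : M) (x : Model n) :
    Model n →ₗ[ℝ] Model n →ₗ[ℝ] ℝ :=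
  have h := exists_baseMetric_eq g' u x
  LinearMap.mk₂ ℝ (baseMetric g' u x)
    (fun _ _ _ => by obtain ⟨B, D, h⟩ := h; simp [h])
    (fun _ _ _ => by obtain ⟨B, D, h⟩ := h; simp [h])
    (fun _ _ _ => by obtain ⟨B, D, h⟩ := h; simp [h])
    (fun _ _ _ => by obtain ⟨B, D, h⟩ := h; simp [h])

theorem baseForm_apply (g' : Metric n M) (u : M) (x a b : Model n) :
    baseForm g' u x a b = baseMetric g' u x a b := rfl

theorem baseMetric_zero_left (g' : Metric n M) (u : M) (x b : Model n) :
    baseMetric g' u x 0 b = 0 := by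
  rw [← baseForm_apply]; simp

theorem baseMetric_zero_right (g' : Metric n M) (u : M) (x b : Model n) :
    baseMetric g' u x b 0 = 0 := by
  rw [← baseForm_apply]; simp

/-- The inverse chart has injective derivative at the centre, so positivity of `g'` pulls back. -/
theorem baseMetric_pos (g' : Metric n M) (u : M) {a : Model n} (ha : a ≠ 0) :
    0 < baseMetric g' u (extChartAt (𝓡 n) u u) a a := by
  refine g'.pos _ _ fun h => ha ?_
  have hinv := isInvertible_mfderivWithin_extChartAt_symm (I := 𝓡 n)
    (mem_extChartAt_target (I := 𝓡 n) u)
  rw [ModelWithCorners.range_eq_univ, mfderivWithin_univ] at hinv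
  exact hinv.injective (h.trans (map_zero _).symm)

/-- Needed for the product rule on `λ²g'` in the Christoffel symbols. The fields `x ↦ dψ_x a` along
the inverse chart `ψ` are `C¹`, and the metric is smooth. -/
theorem differentiableAt_baseMetric (g' : Metric n M) (u : M) (a b : Model n) :
    DifferentiableAt ℝ (fun x => baseMetric g' u x a b) (extChartAt (𝓡 n) u u) := by
  set x₀ := extChartAt (𝓡 n) u u
  set ψ := (extChartAt (𝓡 n) u).symm
  have htgt : (extChartAt (𝓡 n) u).target ∈ nhds x₀ := extChartAt_target_mem_nhds u
  have hψ : ContMDiffAt 𝓘(ℝ, Model n) (𝓡 n) 2 ψ x₀ :=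
    (contMDiffOn_extChartAt_symm u).contMDiffAt htgt
  have hv : ∀ a : Model n, ContMDiffAt 𝓘(ℝ, Model n) ((𝓡 n).prod 𝓘(ℝ, Model n)) 1
      (fun x => Bundle.TotalSpace.mk' (Model n) (E := fun u : M => TangentSpace (𝓡 n) u) (ψ x)
        (mfderiv 𝓘(ℝ, Model n) (𝓡 n) ψ x a)) x₀ := by
    intro a
    have hD := ContMDiffAt.mfderiv_const (m := 1) (n := 2) (x₀ := x₀) hψ (by norm_num)
    have hc : ContMDiffAt 𝓘(ℝ, Model n) (𝓘(ℝ, Model n).prod 𝓘(ℝ, Model n)) 1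
        (fun x => Bundle.TotalSpace.mk' (Model n)
          (E := fun x : Model n => TangentSpace 𝓘(ℝ, Model n) x) x a) x₀ :=
      contMDiffAt_vectorSpace_iff_contDiffAt.2 contDiffAt_const
    exact ContMDiffAt.clm_apply_of_inCoordinates (b₁ := fun x : Model n => x) (b₂ := ψ)
      (E₁ := fun x : Model n => TangentSpace 𝓘(ℝ, Model n) x)
      (E₂ := fun u : M => TangentSpace (𝓡 n) u)
      (ϕ := fun x => mfderiv 𝓘(ℝ, Model n) (𝓡 n) ψ x) (v := fun x => a) hD hc
      (hψ.of_le (by norm_num))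
  have hg := (g'.contMDiff.of_le (m := 1) (by norm_num)).contMDiffAt (x := ψ x₀) 
  have h := ContMDiffAt.clm_bundle_apply₂ (F₁ := Model n) (F₂ := Model n) (F₃ := ℝ)
    (E₃ := Bundle.Trivial M ℝ) (b := ψ) (ψ := fun x => g'.inner (ψ x))
    (hg.comp x₀ (hψ.of_le (by norm_num))) (hv a) (hv b)
  simp only [Bundle.contMDiffAt_totalSpace] at h
  exact (h.2.contDiffAt).differentiableAt (by norm_num)

end BaseMetric

end WarpedProduct

/-! ### Geometry of the graph at a critical point of `r` -/

namespace WarpedProduct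

open Matrix

theorem dotProduct_formMatrix_mulVec {n : ℕ} (B : Model n →ₗ[ℝ] Model n →ₗ[ℝ] ℝ) (v : Fin n → ℝ) :
    v ⬝ᵥ formMatrix (fun a b => B a b) *ᵥ v = B (WithLp.toLp 2 v) (WithLp.toLp 2 v) := by
  have hv : WithLp.toLp 2 v = ∑ i, v i • (EuclideanSpace.single i (1 : ℝ) : Model n) := by
    ext j
    simp [Finset.sum_apply, Pi.single_apply]
  rw [hv]
  simp only [map_sum, map_smul, LinearMap.sum_apply, LinearMap.smul_apply, dotProduct, mulVec,
    formMatrix, of_apply, smul_eq_mul, Finset.mul_sum]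
  rw [Finset.sum_comm]
  exact Finset.sum_congr rfl fun i _ => Finset.sum_congr rfl fun j _ => by ring

section CriticalPoint

variable {n : ℕ} {M : Type*} [TopologicalSpace M] [ChartedSpace (Model n) M]

/-- A function on `M` in the chart around `u`. -/
noncomputable def chartRep (r : M → ℝ) (u : M) (x : Model n) : ℝ := r ((extChartAt (𝓡 n) u).symm x)

theorem chartRep_self (r : M → ℝ) (u : M) : chartRep r u (extChartAt (𝓡 n) u u) = r u := by
  simp [chartRep]

theorem contDiffAt_chartRep {r : M → ℝ} (hr : ContMDiff (𝓡 n) 𝓘(ℝ, ℝ) 2 r) (u : M) :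
    ContDiffAt ℝ 2 (chartRep r u) (extChartAt (𝓡 n) u u) := by
  have h := (contMDiffAt_iff.1 (hr u)).2
  rw [ModelWithCorners.range_eq_univ, contDiffWithinAt_univ] at h
  exact h

theorem tendsto_extChartAt_symm (u : M) :
    Filter.Tendsto (extChartAt (𝓡 n) u).symm (nhds (extChartAt (𝓡 n) u u)) (nhds u) := by
  have h := continuousAt_extChartAt_symm (I := 𝓡 n) u
  rwa [ContinuousAt, extChartAt_to_inv] at h

theorem fderiv_graphParam {r : M → ℝ} {u : M} {y : Model n}
    (hy : DifferentiableAt ℝ (chartRep r u) y) (a : Model n) :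
    fderiv ℝ (graphParam r u) y a = (fderiv ℝ (chartRep r u) y a, a) := by
  have h : fderiv ℝ (graphParam r u) y = _ :=
    (hy.hasFDerivAt.prodMk (hasFDerivAt_id (𝕜 := ℝ) y)).fderiv
  rw [h]
  simp

variable [IsManifold (𝓡 n) ∞ M] (g' : Metric n M) {lam : ℝ → ℝ} {r : M → ℝ} {u : M}

/-- At a critical point of `r` the outer unit normal of the graph is `∂_r`. -/
theorem IsOuterUnitNormal.eq_of_fderiv_eq_zero (hlam : lam (r u) ≠ 0)
    (hr : DifferentiableAt ℝ (chartRep r u) (extChartAt (𝓡 n) u u))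
    (hcrit : fderiv ℝ (chartRep r u) (extChartAt (𝓡 n) u u) = 0) {ν : Tangent n u}
    (hν : IsOuterUnitNormal g' lam r u ν) : ν = ((1 : ℝ), (0 : Model n)) := by
  obtain ⟨h1, h2, h3⟩ := hν
  obtain ⟨s, w⟩ := ν
  change Model n at w
  have hF : ∀ a, fderiv ℝ (graphParam r u) (extChartAt (𝓡 n) u u) a = (0, a) := fun a => by
    rw [fderiv_graphParam hr, hcrit]
    simp
  -- Tangent vectors of the graph are the `(0, a)`; the choice `a = w` makes orthogonality read
  -- `λ²g'(w, w) = 0`.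
  have hw : w = 0 := by
    by_contra hw
    have h := h2 w
    rw [hF] at h
    have hpos := baseMetric_pos g' u hw
    simp only [warpedMetric, mul_zero, zero_add] at h
    exact (mul_pos (by positivity) hpos).ne' h
  subst hw
  simp only [warpedMetric, baseMetric_zero_left, mul_zero, add_zero, mul_one] at h1 h3
  have : s = 1 := by nlinarith
  rw [this]
  rfl

theorem isOuterUnitNormal_of_fderiv_eq_zero
    (hr : DifferentiableAt ℝ (chartRep r u) (extChartAt (𝓡 n) u u))
    (hcrit : fderiv ℝ (chartRep r u) (extChartAt (𝓡 n) u u) = 0) :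
    IsOuterUnitNormal g' lam r u ((1 : ℝ), (0 : Model n)) := by
  have hF : ∀ a, fderiv ℝ (graphParam r u) (extChartAt (𝓡 n) u u) a = (0, a) := fun a => by
    rw [fderiv_graphParam hr, hcrit]
    simp
  refine ⟨?_, fun a => ?_, ?_⟩
  · simp [warpedMetric, baseMetric_zero_left]
  · rw [hF]
    simp [warpedMetric, baseMetric_zero_left]
  · simp [warpedMetric, baseMetric_zero_left]

/-- The Christoffel symbols `Γ_{ab,r}` of the warped product. -/
theorem christoffel_warpedMetric (hlam : DifferentiableAt ℝ lam (r u)) (a b : Model n) :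
    christoffel (warpedMetric g' lam u) (r u, extChartAt (𝓡 n) u u) (0, a) (0, b) (1, 0)
      = -(lam (r u) * deriv lam (r u) * baseMetric g' u (extChartAt (𝓡 n) u u) a b) := by
  set x₀ := extChartAt (𝓡 n) u u
  -- Horizontal vectors stay orthogonal to `∂_r`, so only the radial derivative of `λ²g'(a, b)`
  -- survives in the Koszul formula.
  have h1 : ∀ c : Model n,
      (fun q : ℝ × Model n => warpedMetric g' lam u q (0, c) (1, 0)) = fun _ => 0 := fun c => by
    ext q
    simp [warpedMetric, baseMetric_zero_right]
  have hB := (differentiableAt_baseMetric g' u a b).hasFDerivAt.comp (r u, x₀)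
    (hasFDerivAt_snd (𝕜 := ℝ) (E := ℝ) (F := Model n) (p := (r u, x₀)))
  have hL := (hlam.hasDerivAt.hasFDerivAt.comp (r u, x₀)
    (hasFDerivAt_fst (𝕜 := ℝ) (E := ℝ) (F := Model n) (p := (r u, x₀)))).pow 2
  have hG := (hL.mul hB).fderiv
  have h2 : (fun q : ℝ × Model n => warpedMetric g' lam u q (0, a) (0, b))
      = (fun q => (lam ∘ Prod.fst) q ^ 2) * ((fun x => baseMetric g' u x a b) ∘ Prod.snd) := by
    ext q
    simp [warpedMetric]
  rw [christoffel, h1, h1, h2, hG]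
  simp
  ring

/-- The first fundamental form at a critical point of `r`, as a bilinear map. -/
noncomputable def critFirst (lam : ℝ → ℝ) (r : M → ℝ) (u : M) : Model n →ₗ[ℝ] Model n →ₗ[ℝ] ℝ :=
  lam (r u) ^ 2 • baseForm g' u (extChartAt (𝓡 n) u u)

/-- The second fundamental form at a critical point of `r`, as a bilinear map. -/
noncomputable def critSecond (lam : ℝ → ℝ) (r : M → ℝ) (u : M) : Model n →ₗ[ℝ] Model n →ₗ[ℝ] ℝ :=
  (lam (r u) * deriv lam (r u)) • baseForm g' u (extChartAt (𝓡 n) u u)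
    - (fderiv ℝ (fderiv ℝ (chartRep r u)) (extChartAt (𝓡 n) u u)).toLinearMap₁₂

/-- With `dr = 0` the second derivative of the parametrisation is the purely radial `(D²r, 0)`, and
the normal `∂_r` sees only `Γ_{ab,r}`. No Christoffel symbols of `g'` enter. -/
theorem graphEta_of_fderiv_eq_zero (hlam : DifferentiableAt ℝ lam (r u))
    (hr : ContDiffAt ℝ 2 (chartRep r u) (extChartAt (𝓡 n) u u))
    (hcrit : fderiv ℝ (chartRep r u) (extChartAt (𝓡 n) u u) = 0) :
    graphEta g' lam r u ((1 : ℝ), (0 : Model n)) =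
      etaMatrix (formMatrix fun a b => critFirst g' lam r u a b)
        (formMatrix fun a b => critSecond g' lam r u a b) := by
  set x₀ := extChartAt (𝓡 n) u u with hx₀
  have hdiff : ∀ᶠ y in nhds x₀, DifferentiableAt ℝ (chartRep r u) y :=
    (hr.eventually (by simp)).mono fun y hy => hy.differentiableAt (by norm_num)
  have hD : DifferentiableAt ℝ (fderiv ℝ (chartRep r u)) x₀ :=
    (hr.fderiv_right (m := 1) (by norm_num)).differentiableAt (by norm_num)
  have hF0 : ∀ a, fderiv ℝ (graphParam r u) x₀ a = (0, a) := fun a => by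
    rw [fderiv_graphParam hdiff.self_of_nhds, hcrit]
    simp
  have hFF : ∀ a b, fderiv ℝ (fun y => fderiv ℝ (graphParam r u) y b) x₀ a
      = (fderiv ℝ (fderiv ℝ (chartRep r u)) x₀ a b, 0) := fun a b => by
    -- The formula is needed on a neighbourhood, since it is differentiated again.
    have h1 : (fun y => fderiv ℝ (graphParam r u) y b) =ᶠ[nhds x₀]
        fun y => (fderiv ℝ (chartRep r u) y b, b) := hdiff.mono fun y hy => fderiv_graphParam hy b
    rw [h1.fderiv_eq]
    have h2 := ((hD.hasFDerivAt.clm_apply (hasFDerivAt_const b x₀)).prodMk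
      (hasFDerivAt_const b x₀)).fderiv
    rw [h2]
    simp
  have hpt : graphParam r u x₀ = (r u, x₀) := by
    simp [graphParam, hx₀]
  have h1 : firstFundamental (warpedMetric g' lam u) (graphParam r u) x₀
      = fun a b => critFirst g' lam r u a b := by
    ext a b
    rw [firstFundamental, hF0, hF0, hpt]
    simp [warpedMetric, critFirst, baseForm_apply, hx₀]
  have h2 : secondFundamental (warpedMetric g' lam u) (graphParam r u) x₀
      ((1 : ℝ), (0 : Model n)) = fun a b => critSecond g' lam r u a b := by
    ext a b
    rw [secondFundamental, hF0, hF0, hpt, hFF, hx₀, christoffel_warpedMetric g' hlam]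
    simp [warpedMetric, critSecond, baseForm_apply, baseMetric_zero_left]
    ring
  exact congrArg₂ etaMatrix (congrArg formMatrix h1) (congrArg formMatrix h2)

/-- The eigenvalues of `g⁻¹ η` at a critical point of `r`. -/
theorem exists_roots_charpoly_graphEta (hpos : 0 < lam (r u)) (hlam : DifferentiableAt ℝ lam (r u))
    (hr : ContDiffAt ℝ 2 (chartRep r u) (extChartAt (𝓡 n) u u))
    (hcrit : fderiv ℝ (chartRep r u) (extChartAt (𝓡 n) u u) = 0) :
    ∃ κ : Fin n → ℝ,
      (graphEta g' lam r u ((1 : ℝ), (0 : Model n))).charpoly.roots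
        = Finset.univ.val.map (fun i => ∑ j, κ j - κ i) ∧
      ∀ i, ∃ v : Model n, κ i = deriv lam (r u) / lam (r u)
        - fderiv ℝ (fderiv ℝ (chartRep r u)) (extChartAt (𝓡 n) u u) v v := by
  set x₀ := extChartAt (𝓡 n) u u
  rw [graphEta_of_fderiv_eq_zero g' hlam hr hcrit]
  have hsymm : IsSymmSndFDerivAt ℝ (chartRep r u) x₀ := hr.isSymmSndFDerivAt (by simp)
  have hg : (formMatrix fun a b => critFirst g' lam r u a b).PosDef := by
    refine PosDef.of_dotProduct_mulVec_pos ?_ fun v hv => ?_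
    · ext i j
      simp [formMatrix, critFirst, baseForm_apply, baseMetric_symm g' u _ (.single i 1)]
    · rw [star_trivial, dotProduct_formMatrix_mulVec]
      have := baseMetric_pos g' u (a := WithLp.toLp 2 v) (by simpa using hv)
      simp only [critFirst, LinearMap.smul_apply, baseForm_apply, smul_eq_mul]
      positivity
  have hh : (formMatrix fun a b => critSecond g' lam r u a b)ᵀ
      = formMatrix fun a b => critSecond g' lam r u a b := by
    ext i j
    simp [formMatrix, critSecond, baseForm_apply, baseMetric_symm g' u _ (.single i 1)]
    exact hsymm.eq _ _
  obtain ⟨κ, h1, h2⟩ := exists_roots_charpoly_etaMatrix hg hh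
  refine ⟨κ, h1, fun i => ?_⟩
  obtain ⟨v, hv1, hv2⟩ := h2 i
  refine ⟨WithLp.toLp 2 v, ?_⟩
  rw [dotProduct_formMatrix_mulVec] at hv1 hv2
  rw [← hv2]
  simp only [critFirst, critSecond, LinearMap.smul_apply, LinearMap.sub_apply, smul_eq_mul] at hv1 ⊢
  -- The factor `1` is replaced by `λ²g'(v, v)`, as `v` is `g`-unit; this matches `ζ` with `λλ'g'(v,
  -- v)`.
  have : deriv lam (r u) / lam (r u) = deriv lam (r u) / lam (r u) * 1 := by ring
  rw [this, ← hv1]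
  congr 1
  field_simp

end CriticalPoint

end WarpedProduct

/-! ### Comparison with slices at extrema of `r` -/

namespace WarpedProduct

section Comparison

variable {n : ℕ} {M : Type*} [TopologicalSpace M] [ChartedSpace (Model n) M]

theorem isLocalMax_chartRep {r : M → ℝ} {u : M} (h : IsLocalMax r u) :
    IsLocalMax (chartRep r u) (extChartAt (𝓡 n) u u) := by
  rw [IsLocalMax, IsMaxFilter, chartRep_self]
  exact (tendsto_extChartAt_symm u).eventually h

theorem isLocalMin_chartRep {r : M → ℝ} {u : M} (h : IsLocalMin r u) :
    IsLocalMin (chartRep r u) (extChartAt (𝓡 n) u u) := by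
  rw [IsLocalMin, IsMinFilter, chartRep_self]
  exact (tendsto_extChartAt_symm u).eventually h

theorem chartRep_const (s : ℝ) (u : M) : chartRep (n := n) (fun _ : M => s) u = fun _ => s := rfl

variable [IsManifold (𝓡 n) ∞ M] (g' : Metric n M) {lam : ℝ → ℝ} {r : M → ℝ} {u : M}

/-- At a maximum of `r` the curvature quotient is at least that of the slice. -/
theorem sliceValue_le_of_isLocalMax {k l : ℕ} (hn : 2 ≤ n) (hlk : l ≤ k) (hkn : k ≤ n)
    (hpos : 0 < lam (r u)) (hlam : DifferentiableAt ℝ lam (r u)) (hlam' : 0 < deriv lam (r u))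
    (hr : ContMDiff (𝓡 n) 𝓘(ℝ, ℝ) 2 r) (hmax : IsLocalMax r u) :
    sliceValue n k l lam (r u) ≤ sigma k (graphEta g' lam r u ((1 : ℝ), (0 : Model n)))
      / sigma l (graphEta g' lam r u ((1 : ℝ), (0 : Model n))) := by
  have hmax' := isLocalMax_chartRep (n := n) hmax
  have hr' := contDiffAt_chartRep hr u
  obtain ⟨κ, hroots, hκ⟩ := exists_roots_charpoly_graphEta g' hpos hlam hr' hmax'.fderiv_eq_zero
  have hκ' : ∀ i, deriv lam (r u) / lam (r u) ≤ κ i := fun i => by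
    obtain ⟨v, hv⟩ := hκ i
    have := hmax'.fderiv_fderiv_apply_nonpos hr' v
    linarith
  have hζ : 0 < deriv lam (r u) / lam (r u) := div_pos hlam' hpos
  have hn' : (0 : ℝ) < n - 1 := by
    have : (2 : ℝ) ≤ n := by exact_mod_cast hn
    linarith
  have h := Multiset.le_esymm_div_esymm (s := Finset.univ.val.map (fun i => ∑ j, κ j - κ i))
    (mul_pos hn' hζ) (fun x hx => by
      obtain ⟨i, -, rfl⟩ := Multiset.mem_map.1 hx
      -- `μ_i` is the sum of the other `n - 1` principal curvatures, each at least `ζ`.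
      rw [← Finset.add_sum_erase _ _ (Finset.mem_univ i), add_sub_cancel_left]
      have := Finset.card_nsmul_le_sum (Finset.univ.erase i) κ _ fun j _ => hκ' j
      rw [Finset.card_erase_of_mem (Finset.mem_univ i), Finset.card_univ, Fintype.card_fin,
        nsmul_eq_mul, Nat.cast_sub (by lia)] at this
      simpa using this) hlk (by simpa using hkn)
  rw [sigma, sigma, hroots]
  simpa [sliceValue] using h

/-- At a minimum of `r` the curvature quotient of an `(η, k)`-convex graph is at most that of the
slice. -/
theorem le_sliceValue_of_isLocalMin {k l : ℕ} (hn : 2 ≤ n) (hlk : l ≤ k) (hkn : k ≤ n)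
    (hpos : 0 < lam (r u)) (hlam : DifferentiableAt ℝ lam (r u)) (hlam' : 0 < deriv lam (r u))
    (hr : ContMDiff (𝓡 n) 𝓘(ℝ, ℝ) 2 r) (hmin : IsLocalMin r u)
    (hconv : ∀ j, 1 ≤ j → j ≤ k →
      0 < sigma j (graphEta g' lam r u ((1 : ℝ), (0 : Model n)))) :
    sigma k (graphEta g' lam r u ((1 : ℝ), (0 : Model n)))
      / sigma l (graphEta g' lam r u ((1 : ℝ), (0 : Model n))) ≤ sliceValue n k l lam (r u) := by
  have hmin' := isLocalMin_chartRep (n := n) hmin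
  have hr' := contDiffAt_chartRep hr u
  obtain ⟨κ, hroots, hκ⟩ := exists_roots_charpoly_graphEta g' hpos hlam hr' hmin'.fderiv_eq_zero
  have hκ' : ∀ i, κ i ≤ deriv lam (r u) / lam (r u) := fun i => by
    obtain ⟨v, hv⟩ := hκ i
    have := hmin'.fderiv_fderiv_apply_nonneg hr' v
    linarith
  have hζ : 0 < deriv lam (r u) / lam (r u) := div_pos hlam' hpos
  have hn' : (0 : ℝ) < n - 1 := by
    have : (2 : ℝ) ≤ n := by exact_mod_cast hn
    linarith
  simp only [sigma, hroots] at hconv ⊢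
  have h := Multiset.esymm_div_esymm_le (s := Finset.univ.val.map (fun i => ∑ j, κ j - κ i))
    (mul_pos hn' hζ) (by
      have h1 : ∑ j, κ j ≤ n * (deriv lam (r u) / lam (r u)) := by
        simpa using Finset.sum_le_card_nsmul Finset.univ κ _ fun j _ => hκ' j
      -- Only the trace is used: each `κ_j` occurs in `n - 1` of the `μ_i`.
      have h2 : ((Finset.univ.val.map (fun i => ∑ j, κ j - κ i)).sum : ℝ)
          = (n - 1) * ∑ j, κ j := by
        change ∑ i, (∑ j, κ j - κ i) = _
        rw [Finset.sum_sub_distrib, Finset.sum_const, Finset.card_univ, Fintype.card_fin,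
          nsmul_eq_mul]
        ring
      rw [h2, Multiset.card_map, Finset.card_val, Finset.card_univ, Fintype.card_fin]
      calc ((n : ℝ) - 1) * ∑ j, κ j ≤ (n - 1) * (n * (deriv lam (r u) / lam (r u))) := by gcongr
        _ = n * ((n - 1) * (deriv lam (r u) / lam (r u))) := by ring)
    hlk (by simpa using hkn) hconv
  simpa [sliceValue] using h

/-- The elementary symmetric functions of `μ(η)` on a slice. -/
theorem sigma_graphEta_const {s : ℝ} (hpos : 0 < lam s) (hlam : DifferentiableAt ℝ lam s)
    (u : M) (j : ℕ) :
    sigma j (graphEta g' lam (fun _ => s) u ((1 : ℝ), (0 : Model n)))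
      = n.choose j * (((n : ℝ) - 1) * (deriv lam s / lam s)) ^ j := by
  obtain ⟨κ, hroots, hκ⟩ := exists_roots_charpoly_graphEta (r := fun _ : M => s) (u := u) g' hpos
    hlam (by rw [chartRep_const]; exact contDiffAt_const) (by rw [chartRep_const]; simp)
  have hκ' : κ = fun _ => deriv lam s / lam s := by
    ext i
    obtain ⟨v, hv⟩ := hκ i
    rw [hv, chartRep_const]
    have : fderiv ℝ (fun _ : Model n => s) = fun _ => 0 := by
      ext1 x
      simp
    rw [this]
    simp
  have h : Finset.univ.val.map (fun i => ∑ j, κ j - κ i)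
      = Multiset.replicate n (((n : ℝ) - 1) * (deriv lam s / lam s)) := by
    rw [hκ', Multiset.map_const']
    simp only [Finset.sum_const, Finset.card_univ, Fintype.card_fin, nsmul_eq_mul, Finset.card_val]
    congr 1
    ring
  rw [sigma, hroots, h, Multiset.esymm_replicate]

end Comparison

theorem sliceValue_pos {n k l : ℕ} (hn : 2 ≤ n) (hkn : k ≤ n) (hln : l ≤ n) {lam : ℝ → ℝ} {s : ℝ}
    (hpos : 0 < lam s) (hlam' : 0 < deriv lam s) : 0 < sliceValue n k l lam s := by
  have hn' : (0 : ℝ) < n - 1 := by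
    have : (2 : ℝ) ≤ n := by exact_mod_cast hn
    linarith
  have h1 : (0 : ℝ) < n.choose k := by exact_mod_cast Nat.choose_pos hkn
  have h2 : (0 : ℝ) < n.choose l := by exact_mod_cast Nat.choose_pos hln
  rw [sliceValue]
  positivity

end WarpedProduct
-- The main theorem
theorem mainTheorem5 {n k l : ℕ} (hk : 2 ≤ k) (hkn : k ≤ n) (hlk : l + 2 ≤ k)
    {M : Type*} [TopologicalSpace M] [T2Space M] [CompactSpace M]
    [ChartedSpace (WarpedProduct.Model n) M] [IsManifold (𝓡 n) ∞ M] (g' : WarpedProduct.Metric n M)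
    (J : Set ℝ) (hJo : IsOpen J) (hJc : J.OrdConnected)
    (lam : ℝ → ℝ) (hlam : ContDiffOn ℝ 2 lam J) (hlam_pos : ∀ s ∈ J, 0 < lam s)
    (hlam' : ∀ s ∈ J, 0 < deriv lam s)
    (r₁ r₂ : ℝ) (hr₁ : r₁ ∈ J) (hr₂ : r₂ ∈ J) (hr : r₁ < r₂)
    (φ : ℝ → ℝ) (hφ : DifferentiableOn ℝ φ J) (hφ_pos : ∀ s ∈ J, 0 < φ s)
    (hφ₁ : ∀ s ∈ J, s ≤ r₁ → 1 ≤ φ s) (hφ₂ : ∀ s ∈ J, r₂ ≤ s → φ s ≤ 1)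
    (hφ' : ∀ s ∈ J, deriv φ s < 0)
    (f : ∀ p : ℝ × M, WarpedProduct.Tangent n p.2 → ℝ) :
    (∃! r₀ : ℝ, r₀ ∈ J ∧ φ r₀ = 1) ∧
    ∀ r₀ ∈ J, φ r₀ = 1 →
      ∀ S : Set (ℝ × M),
        WarpedProduct.IsConvexSolution k l g' J lam φ f 0 S ↔ S = {p | p.1 = r₀} := by

  have hn : 2 ≤ n := hk.trans hkn
  have hint : interior J = J := hJo.interior_eq
  have hanti : StrictAntiOn φ J :=
    strictAntiOn_of_deriv_neg hJc.convex hφ.continuousOn fun s hs => hφ' s (hint ▸ hs)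
  have hdl : ∀ s ∈ J, DifferentiableAt ℝ lam s := fun s hs =>
    (hlam.contDiffAt (hJo.mem_nhds hs)).differentiableAt (by norm_num)
  refine ⟨?_, fun r₀ hr₀ hφr₀ S => ⟨?_, ?_⟩⟩
  · have hsub : Set.Icc r₁ r₂ ⊆ J := hJc.out hr₁ hr₂
    obtain ⟨r₀, hr₀, h⟩ := intermediate_value_Icc' hr.le (hφ.continuousOn.mono hsub)
      ⟨hφ₂ r₂ hr₂ le_rfl, hφ₁ r₁ hr₁ le_rfl⟩
    exact ⟨r₀, ⟨hsub hr₀, h⟩, fun s hs => hanti.injOn hs.1 (hsub hr₀) (hs.2.trans h.symm)⟩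
  · rintro ⟨r, hrs, hrJ, rfl, ν, hν, hconv, heq⟩
    have hν' : ∀ u, fderiv ℝ (WarpedProduct.chartRep r u) (extChartAt (𝓡 n) u u) = 0 →
        ν u = ((1 : ℝ), (0 : WarpedProduct.Model n)) := fun u hu =>
      (hν u).eq_of_fderiv_eq_zero g' (hlam_pos _ (hrJ u)).ne'
        ((WarpedProduct.contDiffAt_chartRep hrs u).differentiableAt (by norm_num)) hu
    have heq' : ∀ u, WarpedProduct.sigma k (WarpedProduct.graphEta g' lam r u (ν u)) /
        WarpedProduct.sigma l (WarpedProduct.graphEta g' lam r u (ν u))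
          = φ (r u) * WarpedProduct.sliceValue n k l lam (r u) := fun u => by
      rw [heq u, WarpedProduct.homotopyRHS]
      ring
    have hslice : ∀ u, 0 < WarpedProduct.sliceValue n k l lam (r u) := fun u =>
      WarpedProduct.sliceValue_pos hn hkn (by lia) (hlam_pos _ (hrJ u)) (hlam' _ (hrJ u))
    have hconst : ∀ u, r u = r₀ := fun u => by
      -- `M` may be empty; the given point `u` ensures that the extrema exist.
      have : Nonempty M := ⟨u⟩
      have hrc := hrs.continuous.continuousOn (s := Set.univ)
      obtain ⟨a, -, ha⟩ := isCompact_univ.exists_isMaxOn Set.univ_nonempty hrc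
      obtain ⟨b, -, hb⟩ := isCompact_univ.exists_isMinOn Set.univ_nonempty hrc
      have ha' : IsLocalMax r a := Filter.Eventually.of_forall fun x => ha (Set.mem_univ x)
      have hb' : IsLocalMin r b := Filter.Eventually.of_forall fun x => hb (Set.mem_univ x)
      have h1 := WarpedProduct.sliceValue_le_of_isLocalMax g' (k := k) (l := l) hn (by lia) hkn
        (hlam_pos _ (hrJ a)) (hdl _ (hrJ a)) (hlam' _ (hrJ a)) hrs ha'
      have hνb := hν' b (WarpedProduct.isLocalMin_chartRep hb').fderiv_eq_zero
      have h2 := WarpedProduct.le_sliceValue_of_isLocalMin g' (k := k) (l := l) hn (by lia) hkn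
        (hlam_pos _ (hrJ b)) (hdl _ (hrJ b)) (hlam' _ (hrJ b)) hrs hb'
        (fun j hj hjk => hνb ▸ hconv b j hj hjk)
      have heqa := heq' a
      have heqb := heq' b
      rw [hν' a (WarpedProduct.isLocalMax_chartRep ha').fderiv_eq_zero] at heqa
      rw [hνb] at heqb
      replace h1 := h1.trans_eq heqa
      replace h2 := heqb.symm.trans_le h2
      -- Cancelling the positive slice value leaves `1 ≤ φ (r a)`, and likewise `φ (r b) ≤ 1`; as
      -- `φ` decreases, `max r ≤ r₀ ≤ min r`.
      have h3 : φ r₀ ≤ φ (r a) := by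
        rw [hφr₀]
        exact le_of_mul_le_mul_right (by rwa [one_mul]) (hslice a)
      have h4 : φ (r b) ≤ φ r₀ := by
        rw [hφr₀]
        exact le_of_mul_le_mul_right (by rwa [one_mul]) (hslice b)
      have h5 := (hanti.le_iff_ge hr₀ (hrJ a)).1 h3
      have h6 := (hanti.le_iff_ge (hrJ b) hr₀).1 h4
      exact le_antisymm ((ha (Set.mem_univ u)).trans h5) (h6.trans (hb (Set.mem_univ u)))
    simp only [hconst]
  · rintro rfl
    have hpos := hlam_pos _ hr₀
    have hζ : 0 < deriv lam r₀ / lam r₀ := div_pos (hlam' _ hr₀) hpos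
    have hn' : (0 : ℝ) < n - 1 := by
      have : (2 : ℝ) ≤ n := by exact_mod_cast hn
      linarith
    have hC : ∀ j ≤ n, (0 : ℝ) < n.choose j := fun j hj => by exact_mod_cast Nat.choose_pos hj
    refine ⟨fun _ => r₀, contMDiff_const, fun _ => hr₀, rfl,
      fun _ => ((1 : ℝ), (0 : WarpedProduct.Model n)), fun u => ?_, fun u j hj hjk => ?_,
      fun u => ?_⟩
    · exact WarpedProduct.isOuterUnitNormal_of_fderiv_eq_zero g'
        (by rw [WarpedProduct.chartRep_const]; simp) (by rw [WarpedProduct.chartRep_const]; simp)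
    · rw [WarpedProduct.sigma_graphEta_const g' hpos (hdl _ hr₀)]
      exact mul_pos (hC j (hjk.trans hkn)) (by positivity)
    · rw [WarpedProduct.sigma_graphEta_const g' hpos (hdl _ hr₀),
        WarpedProduct.sigma_graphEta_const g' hpos (hdl _ hr₀), WarpedProduct.homotopyRHS, hφr₀,
        WarpedProduct.sliceValue]
      have hc := mul_pos hn' hζ
      have hCl := hC l (by lia)
      generalize ((n : ℝ) - 1) * (deriv lam r₀ / lam r₀) = c at *
      rw [show c ^ k = c ^ (k - l) * c ^ l by rw [← pow_add]; congr 1; lia]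
      field_simp
      ring
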